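/- Let $d \ge 1$, let $V, r > 0$ be real numbers, and let $M \subset \mathbb{R}^d$ be a compact set with $\mathcal{H}^d(M) = V$. Here $\mathcal{H}^k$ denotes $k$-dimensional Hausdorff measure, normalized so that $\mathcal{H}^d$ is Lebesgue measure on $\mathbb{R}^d$, and $\omega_k$ denotes the volume of the unit ball of $\mathbb{R}^k$ (so $\omega_0 = 1$). A \emph{maximal distance $r$-minimizer} for $M$ is a nonempty connected compact set $\Sigma \subset \mathbb{R}^d$ with $\max_{y \in M} \operatorname{dist}(y, \Sigma) \le r$ whose length $\mathcal{H}^1(\Sigma)$ is minimal among all nonempty connected compact sets with this property. Then every maximal distance $r$-minimizer $\Sigma$ for $M$ satisfies \[ \mathcal{H}^1(\Sigma) \ \ge\ \max\left(0,\ \frac{V - \omega_d r^d}{\omega_{d-1} r^{d-1}}\right). \] -/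

import Mathlib

open MeasureTheory
open scoped ENNReal

namespace MaximalDistance

/-- The volume `ω k` of the unit ball of `ℝ^k`; in particular `ω 0 = 1`. -/
noncomputable def omega (k : ℕ) : ℝ :=
  (volume (Metric.ball (0 : EuclideanSpace ℝ (Fin k)) 1)).toReal

/-- The length of a set: its one-dimensional Hausdorff measure. -/
noncomputable def length {d : ℕ} (S : Set (EuclideanSpace ℝ (Fin d))) : ℝ≥0∞ :=
  Measure.hausdorffMeasure 1 S

/-- The energy `F_M(S) = max_{y ∈ M} dist (y, S)`, with values in `[0, ∞]`.
The supremum is a maximum when `M` is compact and nonempty. -/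
noncomputable def energy {d : ℕ} (M S : Set (EuclideanSpace ℝ (Fin d))) : ℝ≥0∞ :=
  ⨆ y ∈ M, Metric.infEDist y S

/-- `S` is admissible for the data `M`, `r`: a connected compact set with `F_M(S) ≤ r`. -/
structure IsAdmissible {d : ℕ} (M : Set (EuclideanSpace ℝ (Fin d))) (r : ℝ)
    (S : Set (EuclideanSpace ℝ (Fin d))) : Prop where
  isCompact : IsCompact S
  isConnected : IsConnected S
  energy_le : energy M S ≤ ENNReal.ofReal r

/-- `S` is a maximal distance `r`-minimizer for `M`: it has minimal length among all connected
compact sets `T` with `F_M(T) ≤ r`. -/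
structure IsRMinimizer {d : ℕ} (M : Set (EuclideanSpace ℝ (Fin d))) (r : ℝ)
    (S : Set (EuclideanSpace ℝ (Fin d))) : Prop where
  isAdmissible : IsAdmissible M r S
  length_le : ∀ T : Set (EuclideanSpace ℝ (Fin d)), IsAdmissible M r T → length S ≤ length T

end MaximalDistance

/-! `M` lies in the closed `r`-neighbourhood of `S`, so it is enough to bound the volume of that
tube by `ω_d r^d + ω_{d-1} r^{d-1} H¹(S)`. A ball moved along a chord gains at most the volume of a
cylinder over the chord (`volume_ball_diff_ball_le`). Summed over subdivisions of an arc, this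
bounds the tube of the arc minus its end ball (`volume_thickening_image_diff_ball_le`).

A continuum of finite length is arcwise connected (`IsPreconnected.exists_injOn_path`), so a finite
net in `S` can be joined up by arcs, each meeting the earlier part only at its endpoint. The end
ball is then already counted and the lengths add, so only one full ball is ever paid for. A fine net
gives the tube bound with any `ρ > r`; finally `ρ` tends to `r`. -/

/-! ### Volume swept by a moving ball -/

/-- A Euclidean space of dimension `n + 1` splits off a line in any given direction. -/
theorem exists_linearIsometryEquiv_prod_map_eq {n : ℕ} (v : EuclideanSpace ℝ (Fin (n + 1))) :
    ∃ φ : EuclideanSpace ℝ (Fin (n + 1)) ≃ₗᵢ[ℝ] WithLp 2 (ℝ × EuclideanSpace ℝ (Fin n)),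
      φ v = WithLp.toLp 2 (‖v‖, 0) := by
  have hfin : Module.finrank ℝ (WithLp 2 (ℝ × EuclideanSpace ℝ (Fin n))) = n + 1 := by
    rw [(WithLp.linearEquiv 2 ℝ (ℝ × EuclideanSpace ℝ (Fin n))).finrank_eq]
    simp [add_comm]
  let ψ := ((stdOrthonormalBasis ℝ (WithLp 2 (ℝ × EuclideanSpace ℝ (Fin n)))).reindex
    (finCongr hfin)).repr.symm
  have hnorm : ‖ψ v‖ = ‖(WithLp.toLp 2 (‖v‖, 0) : WithLp 2 (ℝ × EuclideanSpace ℝ (Fin n)))‖ := by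
    rw [ψ.norm_map, WithLp.prod_norm_eq_of_L2]
    simp
  -- Two vectors of equal norm are exchanged by the reflection in the hyperplane orthogonal to their
  -- difference.
  exact ⟨ψ.trans (Submodule.reflection _), Submodule.reflection_sub hnorm⟩

/-- Moving a ball of radius `ρ` sweeps out at most the volume of a cylinder. -/
theorem volume_ball_diff_ball_le {n : ℕ} (p q : EuclideanSpace ℝ (Fin (n + 1))) {ρ : ℝ}
    (hρ : 0 < ρ) :
    volume (Metric.ball p ρ \ Metric.ball q ρ) ≤
      volume (Metric.ball (0 : EuclideanSpace ℝ (Fin n)) ρ) * edist p q := by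
  obtain ⟨φ, hφ⟩ := exists_linearIsometryEquiv_prod_map_eq (q - p)
  set l := ‖q - p‖ with hl
  have hl0 : 0 ≤ l := norm_nonneg _
  let A : Set (ℝ × EuclideanSpace ℝ (Fin n)) :=
    {z | z.1 ^ 2 + ‖z.2‖ ^ 2 < ρ ^ 2} ∩ {z | ρ ^ 2 ≤ (z.1 - l) ^ 2 + ‖z.2‖ ^ 2}
  have hA : MeasurableSet A := by
    refine MeasurableSet.inter ?_ ?_
    · exact (isOpen_lt (by fun_prop) (by fun_prop)).measurableSet
    · exact (isClosed_le (by fun_prop) (by fun_prop)).measurableSet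
  have hpre : Metric.ball p ρ \ Metric.ball q ρ =
      (fun x => x - p) ⁻¹' (φ ⁻¹' ((@WithLp.ofLp 2 (ℝ × EuclideanSpace ℝ (Fin n))) ⁻¹' A)) := by
    ext x
    have h1 : dist x p ^ 2 = (φ (x - p)).ofLp.1 ^ 2 + ‖(φ (x - p)).ofLp.2‖ ^ 2 := by
      rw [dist_eq_norm, ← φ.norm_map, WithLp.prod_norm_sq_eq_of_L2]
      simp
    have h2 : dist x q ^ 2 = ((φ (x - p)).ofLp.1 - l) ^ 2 + ‖(φ (x - p)).ofLp.2‖ ^ 2 := by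
      have : x - q = (x - p) - (q - p) := by abel
      rw [dist_eq_norm, this, ← φ.norm_map, map_sub, hφ, WithLp.prod_norm_sq_eq_of_L2]
      simp
    simp only [Set.mem_sdiff, Metric.mem_ball, not_lt, Set.mem_preimage, A, Set.mem_inter_iff,
      Set.mem_ofPred_eq, ← h1, ← h2]
    rw [sq_lt_sq₀ dist_nonneg hρ.le, sq_le_sq₀ hρ.le dist_nonneg]
  have hvol : volume (Metric.ball p ρ \ Metric.ball q ρ) =
      (volume : Measure (ℝ × EuclideanSpace ℝ (Fin n))) A := by
    have hm1 := (measurePreserving_sub_right volume p)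
    have hm2 := φ.measurePreserving
    have hm3 := WithLp.volume_preserving_ofLp ℝ (EuclideanSpace ℝ (Fin n))
    have hA3 : MeasurableSet ((@WithLp.ofLp 2 (ℝ × EuclideanSpace ℝ (Fin n))) ⁻¹' A) :=
      hm3.measurable hA
    rw [hpre, hm1.measure_preimage (hm2.measurable hA3).nullMeasurableSet,
      hm2.measure_preimage hA3.nullMeasurableSet, hm3.measure_preimage hA.nullMeasurableSet]
  have hslice : ∀ x : EuclideanSpace ℝ (Fin n), volume ((fun t : ℝ => (t, x)) ⁻¹' A) ≤
      (Metric.ball (0 : EuclideanSpace ℝ (Fin n)) ρ).indicator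
        (fun _ => ENNReal.ofReal l) x := by
    intro x
    by_cases hx : x ∈ Metric.ball (0 : EuclideanSpace ℝ (Fin n)) ρ
    · rw [Set.indicator_of_mem hx]
      set s := √(ρ ^ 2 - ‖x‖ ^ 2) with hs
      have hxρ : ‖x‖ < ρ := by simpa using hx
      have hss : s ^ 2 = ρ ^ 2 - ‖x‖ ^ 2 := Real.sq_sqrt (by nlinarith [norm_nonneg x])
      have hs0 : 0 ≤ s := Real.sqrt_nonneg _
      -- The balls cut this line in intervals of half-length `s` about `0` and `l`; their difference
      -- lies in an interval of length `l`.
      have hsub : (fun t : ℝ => (t, x)) ⁻¹' A ⊆ Set.Icc (-s) (l - s) := by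
        rintro t ⟨ht1, ht2⟩
        simp only [Set.mem_ofPred_eq] at ht1 ht2
        have h1 : |t| < s := abs_lt_of_sq_lt_sq (by linarith) hs0
        have h2 : s ≤ |t - l| := by
          rw [← abs_of_nonneg hs0]; exact sq_le_sq.1 (by linarith)
        rw [abs_lt] at h1
        refine ⟨h1.1.le, ?_⟩
        rcases le_abs.1 h2 with h | h <;> linarith
      refine (measure_mono hsub).trans ?_
      rw [Real.volume_Icc]
      exact ENNReal.ofReal_le_ofReal (by linarith)
    · rw [Set.indicator_of_notMem hx]
      have hxρ : ρ ≤ ‖x‖ := by simpa using hx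
      have : (fun t : ℝ => (t, x)) ⁻¹' A = ∅ := by
        ext t
        simp only [Set.mem_preimage, Set.mem_empty_iff_false, iff_false]
        rintro ⟨ht1, -⟩
        simp only [Set.mem_ofPred_eq] at ht1
        nlinarith [sq_nonneg t]
      simp [this]
  have hed : edist p q = ENNReal.ofReal l := by
    rw [edist_dist, dist_comm, dist_eq_norm]
  rw [hvol, Measure.volume_eq_prod, Measure.prod_apply_symm hA]
  refine (lintegral_mono hslice).trans ?_
  rw [lintegral_indicator_const measurableSet_ball, mul_comm, hed]

/-! ### Length of connected sets and arcs -/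

section
variable {X : Type*} [MetricSpace X] [MeasurableSpace X] [BorelSpace X]

/-- A connected set reaching from `x` to `y` has length at least `ε` within distance `ε` of `x`. -/
theorem IsPreconnected.ofReal_le_hausdorffMeasure_inter_closedBall {S : Set X}
    (hS : IsPreconnected S) {x y : X} (hx : x ∈ S) (hy : y ∈ S) {ε : ℝ} (hε : ε ≤ dist x y) :
    ENNReal.ofReal ε ≤ Measure.hausdorffMeasure 1 (S ∩ Metric.closedBall x ε) := by
  have hlip : LipschitzWith 1 (fun z => dist z x) := LipschitzWith.dist_left x
  have hsub : Set.Icc 0 ε ⊆ (fun z => dist z x) '' (S ∩ Metric.closedBall x ε) := by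
    rintro t ⟨ht0, ht⟩
    obtain ⟨z, hz, hzt⟩ := hS.intermediate_value hx hy hlip.continuous.continuousOn
      (show t ∈ Set.Icc (dist x x) (dist y x) by
        rw [dist_self, dist_comm]; exact ⟨ht0, ht.trans hε⟩)
    exact ⟨z, ⟨hz, Metric.mem_closedBall.2 (hzt.trans_le ht)⟩, hzt⟩
  calc ENNReal.ofReal ε = Measure.hausdorffMeasure 1 (Set.Icc (0 : ℝ) ε) := by
        rw [hausdorffMeasure_real, Real.volume_Icc, sub_zero]
    _ ≤ _ := measure_mono hsub
    _ ≤ _ := by simpa using hlip.hausdorffMeasure_image_le zero_le_one _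

theorem IsPreconnected.edist_le_hausdorffMeasure {S : Set X}
    (hS : IsPreconnected S) {x y : X} (hx : x ∈ S) (hy : y ∈ S) :
    edist x y ≤ Measure.hausdorffMeasure 1 S := by
  rw [edist_dist]
  exact (hS.ofReal_le_hausdorffMeasure_inter_closedBall hx hy le_rfl).trans
    (measure_mono Set.inter_subset_left)

/-- The length of an arc is superadditive under subdivision. -/
theorem hausdorffMeasure_image_Icc_add_le {γ : ℝ → X} {a b c : ℝ} (hab : a ≤ b) (hbc : b ≤ c)
    (hγ : ContinuousOn γ (Set.Icc a c)) (hinj : Set.InjOn γ (Set.Icc a c)) :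
    Measure.hausdorffMeasure 1 (γ '' Set.Icc a b) + Measure.hausdorffMeasure 1 (γ '' Set.Icc b c) ≤
      Measure.hausdorffMeasure 1 (γ '' Set.Icc a c) := by
  have := Measure.nullSingletonClass_hausdorff X (zero_lt_one (α := ℝ))
  -- Dropping the shared point `γ b`, which is null, makes the two pieces disjoint.
  have h1 : Measure.hausdorffMeasure 1 (γ '' Set.Icc a b) ≤
      Measure.hausdorffMeasure 1 (γ '' Set.Ico a b) := by
    rw [← Set.Ico_insert_right hab, Set.image_insert_eq]
    exact (measure_congr (insert_ae_eq_self _ _)).le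
  have hdisj : Disjoint (γ '' Set.Ico a b) (γ '' Set.Icc b c) := by
    rw [Set.disjoint_left]
    rintro _ ⟨s, hs, rfl⟩ ⟨t, ht, hst⟩
    have := hinj ⟨hab.trans ht.1, ht.2⟩ ⟨hs.1, hs.2.le.trans hbc⟩ hst
    exact (hs.2.trans_le ht.1).ne this.symm
  have hmeas : MeasurableSet (γ '' Set.Icc b c) :=
    (isCompact_Icc.image_of_continuousOn
      (hγ.mono (Set.Icc_subset_Icc_left hab))).isClosed.measurableSet
  rw [← Set.Ico_union_Icc_eq_Icc hab hbc, Set.image_union, measure_union hdisj hmeas]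
  gcongr

end

/-! ### Arcs in continua of finite length -/

/-- A connected set contains chains with arbitrarily small steps between any two of its points;
a chain with the fewest steps keeps nonconsecutive points apart. -/
theorem IsPreconnected.exists_chain {X : Type*} [MetricSpace X] {S : Set X}
    (hS : IsPreconnected S) {x y : X} (hx : x ∈ S) (hy : y ∈ S) {δ : ℝ} (hδ : 0 < δ) :
    ∃ (k : ℕ) (v : ℕ → X), v 0 = x ∧ v k = y ∧ (∀ i, v i ∈ S) ∧
      (∀ i < k, dist (v i) (v (i + 1)) ≤ δ) ∧
      ∀ i j, i + 2 ≤ j → j ≤ k → δ ≤ dist (v i) (v j) := by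
  let G : SimpleGraph S := SimpleGraph.fromRel fun a b => dist a b < δ
  have hadj : ∀ a b : S, dist a b < δ → G.dist a b ≤ 1 ∧ G.Reachable a b := by
    intro a b h
    by_cases hab : a = b
    · subst hab; simp
    · have : G.Adj a b := ⟨hab, Or.inl h⟩
      exact ⟨(SimpleGraph.dist_eq_one_iff_adj.2 this).le, this.reachable⟩
  have : PreconnectedSpace S := isPreconnected_iff_preconnectedSpace.1 hS
  have hreach : {z : S | G.Reachable ⟨x, hx⟩ z} = Set.univ := by
    refine IsClopen.eq_univ ⟨?_, ?_⟩ ⟨⟨x, hx⟩, SimpleGraph.Reachable.refl _⟩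
    · rw [← isOpen_compl_iff, Metric.isOpen_iff]
      exact fun z hz => ⟨δ, hδ, fun w hw hw' => hz (hw'.trans (hadj w z hw).2)⟩
    · rw [Metric.isOpen_iff]
      exact fun z hz => ⟨δ, hδ, fun w hw => hz.trans (hadj w z hw).2.symm⟩
  have hconn : G.Connected := by
    have : Nonempty S := ⟨⟨x, hx⟩⟩
    have h : ∀ z, G.Reachable ⟨x, hx⟩ z := fun z => (Set.ext_iff.1 hreach z).2 trivial
    exact ⟨fun a b => (h a).symm.trans (h b)⟩
  obtain ⟨p, hp⟩ := hconn.exists_walk_length_eq_dist ⟨x, hx⟩ ⟨y, hy⟩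
  refine ⟨p.length, fun i => p.getVert i, by simp, by simp, fun i => (p.getVert i).2, ?_, ?_⟩
  · intro i hi
    rcases (p.adj_getVert_succ hi).2 with h | h
    · exact h.le
    · rw [dist_comm]; exact h.le
  · intro i j hij hj
    by_contra! h
    have h1 := (hadj _ _ h).1
    have h2 := SimpleGraph.dist_le (p.take i)
    have h3 := SimpleGraph.dist_le (p.drop j)
    have h4 := hconn.dist_triangle (u := ⟨x, hx⟩) (v := p.getVert i) (w := ⟨y, hy⟩)
    have h5 := hconn.dist_triangle (u := p.getVert i) (v := p.getVert j) (w := ⟨y, hy⟩)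
    rw [SimpleGraph.Walk.take_length] at h2
    rw [SimpleGraph.Walk.drop_length] at h3
    omega

/-- `f` goes from `x` to `y` inside `S` during `[0, 1]` and is `K`-Lipschitz up to an additive
error `δ`. -/
structure IsAlmostLipschitzPath {X : Type*} [MetricSpace X] (S : Set X) (x y : X) (K δ : ℝ)
    (f : ℝ → X) : Prop where
  source : f 0 = x
  target : f 1 = y
  mem : ∀ t, f t ∈ S
  dist_le : ∀ s t, 0 ≤ s → s ≤ t → t ≤ 1 → dist (f s) (f t) ≤ K * (t - s) + δ

/-- In a connected set of finite length any two points are joined by paths that are Lipschitz up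
to arbitrarily small errors. -/
theorem IsPreconnected.exists_isAlmostLipschitzPath {X : Type*} [MetricSpace X]
    [MeasurableSpace X] [BorelSpace X] {S : Set X} (hS : IsPreconnected S)
    (hcomp : IsCompact S)
    (hfin : Measure.hausdorffMeasure 1 S ≠ ∞) {x y : X} (hx : x ∈ S) (hy : y ∈ S)
    (hxy : x ≠ y) {δ : ℝ} (hδ : 0 < δ) :
    ∃ f, IsAlmostLipschitzPath S x y (6 * (Measure.hausdorffMeasure 1 S).toReal) δ f := by
  wlog hle : δ ≤ dist x y generalizing δ
  · obtain ⟨f, hf⟩ := this (dist_pos.2 hxy) le_rfl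
    exact ⟨f, hf.source, hf.target, hf.mem, fun s t h0 h h1 =>
      (hf.dist_le s t h0 h h1).trans (by linarith)⟩
  obtain ⟨k, v, hv0, hvk, hvS, hstep, hsep⟩ := hS.exists_chain hx hy hδ
  -- Since `δ ≤ dist x y`, one of `x`, `y` is at distance at least `δ / 3` from `v i`.
  have hball : ∀ i, ENNReal.ofReal (δ / 3) ≤
      Measure.hausdorffMeasure 1 (S ∩ Metric.closedBall (v i) (δ / 3)) := by
    intro i
    have htri := dist_triangle_left x y (v i)
    rcases le_or_gt (δ / 3) (dist (v i) x) with h | h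
    · exact hS.ofReal_le_hausdorffMeasure_inter_closedBall (hvS i) hx h
    · exact hS.ofReal_le_hausdorffMeasure_inter_closedBall (hvS i) hy (by linarith)
  have hdisj : Set.PairwiseDisjoint (↑(Finset.range (k / 2 + 1)))
      (fun i => S ∩ Metric.closedBall (v (2 * i)) (δ / 3)) := by
    have key : ∀ i j, i < j → j < k / 2 + 1 → Disjoint
        (S ∩ Metric.closedBall (v (2 * i)) (δ / 3)) (S ∩ Metric.closedBall (v (2 * j)) (δ / 3)) := by
      intro i j hij hj
      refine (Metric.closedBall_disjoint_closedBall ?_).mono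
        Set.inter_subset_right Set.inter_subset_right
      have := hsep (2 * i) (2 * j) (by omega) (by omega)
      linarith
    intro i hi j hj hij
    simp only [Finset.coe_range, Set.mem_Iio] at hi hj
    rcases lt_or_gt_of_ne hij with h | h
    · exact key i j h hj
    · exact (key j i h hi).symm
  -- The factor `6` is `2 * 3`: only even-indexed vertices are used, and each accounts for length `δ
  -- / 3`.
  have hcount : (k : ℝ) * δ ≤ 6 * (Measure.hausdorffMeasure 1 S).toReal := by
    have h1 : ((k / 2 + 1 : ℕ) : ℝ≥0∞) * ENNReal.ofReal (δ / 3) ≤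
        Measure.hausdorffMeasure 1 S := by
      calc ((k / 2 + 1 : ℕ) : ℝ≥0∞) * ENNReal.ofReal (δ / 3)
          = ∑ i ∈ Finset.range (k / 2 + 1), ENNReal.ofReal (δ / 3) := by simp
        _ ≤ ∑ i ∈ Finset.range (k / 2 + 1),
            Measure.hausdorffMeasure 1 (S ∩ Metric.closedBall (v (2 * i)) (δ / 3)) :=
          Finset.sum_le_sum fun i _ => hball _
        _ = Measure.hausdorffMeasure 1 (⋃ i ∈ Finset.range (k / 2 + 1),
            S ∩ Metric.closedBall (v (2 * i)) (δ / 3)) :=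
          (measure_biUnion_finset hdisj fun i _ =>
            (hcomp.isClosed.inter Metric.isClosed_closedBall).measurableSet).symm
        _ ≤ _ := measure_mono (Set.iUnion₂_subset fun i _ => Set.inter_subset_left)
    have h2 := ENNReal.toReal_mono hfin h1
    rw [ENNReal.toReal_mul, ENNReal.toReal_ofReal (by positivity), ENNReal.toReal_natCast] at h2
    have h3 : (k : ℝ) ≤ 2 * ((k / 2 + 1 : ℕ) : ℝ) := by
      exact_mod_cast (by omega : k ≤ 2 * (k / 2 + 1))
    nlinarith
  refine ⟨fun t => v ⌊t * k⌋₊, by simp [hv0], by simp [hvk], fun t => hvS _, ?_⟩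
  intro s t hs hst ht
  have hk : (0 : ℝ) ≤ k := k.cast_nonneg
  have hfloor : ⌊s * k⌋₊ ≤ ⌊t * k⌋₊ := Nat.floor_mono (by gcongr)
  have htk : ⌊t * k⌋₊ ≤ k := by
    refine Nat.floor_le_of_le ?_
    nlinarith
  have h1 : dist (v ⌊s * k⌋₊) (v ⌊t * k⌋₊) ≤ ∑ i ∈ Finset.Ico ⌊s * k⌋₊ ⌊t * k⌋₊, δ :=
    dist_le_Ico_sum_of_dist_le hfloor fun {i} _ hi => hstep i (by omega)
  rw [Finset.sum_const, Nat.card_Ico, nsmul_eq_mul, Nat.cast_sub hfloor] at h1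
  have h2 : (⌊t * k⌋₊ : ℝ) ≤ t * k := Nat.floor_le (by nlinarith)
  have h3 : s * k < ⌊s * k⌋₊ + 1 := Nat.lt_floor_add_one _
  refine h1.trans ?_
  nlinarith [mul_le_mul_of_nonneg_right hcount (sub_nonneg.2 hst)]

/-- Approximately Lipschitz paths in a compact set accumulate at Lipschitz ones. -/
theorem IsCompact.exists_isAlmostLipschitzPath_zero {X : Type*} [MetricSpace X] {S : Set X}
    (hS : IsCompact S) {x y : X} {K : ℝ}
    (h : ∀ δ > 0, ∃ f, IsAlmostLipschitzPath S x y K δ f) :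
    ∃ f, IsAlmostLipschitzPath S x y K 0 f := by
  choose f hf using fun n : ℕ => h (1 / ((n : ℝ) + 1)) Nat.one_div_pos_of_nat
  -- An ultrafilter makes the paths converge at every `t` at once, without passing to subsequences.
  let u : Ultrafilter ℕ := Filter.hyperfilter ℕ
  have hu : (u : Filter ℕ) ≤ Filter.atTop := Nat.hyperfilter_le_atTop
  have hlim : ∀ t, ∃ z ∈ S, Filter.Tendsto (fun n => f n t) u (nhds z) := by
    intro t
    obtain ⟨z, hz, hzt⟩ := hS.ultrafilter_le_nhds (u.map fun n => f n t)
      (Filter.tendsto_principal.2 (Filter.Eventually.of_forall fun n => (hf n).mem t) :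
        Filter.Tendsto (fun n => f n t) u (Filter.principal S))
    exact ⟨z, hz, hzt⟩
  choose g hgS hg using hlim
  refine ⟨g, ?_, ?_, hgS, ?_⟩
  · exact tendsto_nhds_unique (hg 0) (by simp [(hf _).source])
  · exact tendsto_nhds_unique (hg 1) (by simp [(hf _).target])
  · intro s t h0 hst h1
    exact le_of_tendsto_of_tendsto' ((hg s).dist (hg t))
      ((tendsto_one_div_add_atTop_nhds_zero_nat.mono_left hu).const_add _)
      fun n => (hf n).dist_le s t h0 hst h1

/-- Cutting a loop out of a Lipschitz path lowers its Lipschitz constant. -/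
theorem IsAlmostLipschitzPath.cut {X : Type*} [MetricSpace X] {S : Set X} {x y : X} {K : ℝ}
    {f : ℝ → X} (hf : IsAlmostLipschitzPath S x y K 0 f) {a b : ℝ} (ha : 0 ≤ a)
    (hab : a ≤ b) (hb : b ≤ 1) (hfab : f a = f b) :
    ∃ g, IsAlmostLipschitzPath S x y (K * (1 - (b - a))) 0 g := by
  set c := 1 - (b - a) with hc
  have hc0 : 0 ≤ c := by linarith
  -- Skip the time interval from `a` to `b` and run the rest at speed `c`; the pieces fit because `f
  -- a = f b`.
  refine ⟨fun t => if c * t ≤ a then f (c * t) else f (c * t + (b - a)), ?_, ?_, ?_, ?_⟩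
  · simp [ha, hf.source]
  · have h1 : c + (b - a) = 1 := by ring
    simp only [mul_one, h1, hf.target, ite_eq_right_iff]
    intro h
    have hb1 : b = 1 := by linarith
    have : c = a := by linarith
    rw [this, hfab, hb1, hf.target]
  · intro t
    split_ifs <;> exact hf.mem _
  · intro s t hs hst ht
    have h1 : c * s ≤ c * t := by gcongr
    have h2 : c * t ≤ c := by nlinarith
    have h0 : 0 ≤ c * s := by positivity
    split_ifs with h3 h4 h4
    · have := hf.dist_le (c * s) (c * t) h0 h1 (by linarith)
      linarith
    · have h5 := hf.dist_le (c * s) a h0 h3 (by linarith)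
      have h6 := hf.dist_le b (c * t + (b - a)) (by linarith) (by linarith) (by linarith)
      have h7 := dist_triangle (f (c * s)) (f a) (f (c * t + (b - a)))
      rw [← hfab] at h6
      linarith
    · linarith
    · have := hf.dist_le (c * s + (b - a)) (c * t + (b - a)) (by linarith) (by linarith)
        (by linarith)
      linarith

/-- A compact connected set of finite length is arcwise connected. -/
theorem IsPreconnected.exists_injOn_path {X : Type*} [MetricSpace X]
    [MeasurableSpace X] [BorelSpace X] {S : Set X} (hS : IsPreconnected S)
    (hcomp : IsCompact S) (hfin : Measure.hausdorffMeasure 1 S ≠ ∞) {x y : X}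
    (hx : x ∈ S) (hy : y ∈ S) (hxy : x ≠ y) :
    ∃ γ : ℝ → X, ContinuousOn γ (Set.Icc 0 1) ∧ Set.InjOn γ (Set.Icc 0 1) ∧
      γ 0 = x ∧ γ 1 = y ∧ ∀ t, γ t ∈ S := by
  -- The least Lipschitz constant is attained and positive; a path attaining it is injective, since
  -- cutting out a loop would lower it.
  let A : Set ℝ := {K | ∃ f, IsAlmostLipschitzPath S x y K 0 f}
  have hpos : ∀ K ∈ A, dist x y ≤ K := by
    rintro K ⟨f, hf⟩
    have := hf.dist_le 0 1 le_rfl zero_le_one le_rfl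
    rw [hf.source, hf.target] at this
    linarith
  have hbdd : BddBelow A := ⟨dist x y, hpos⟩
  have hne : A.Nonempty := ⟨_, hcomp.exists_isAlmostLipschitzPath_zero fun δ hδ =>
    hS.exists_isAlmostLipschitzPath hcomp hfin hx hy hxy hδ⟩
  have hmin : sInf A ∈ A := by
    refine hcomp.exists_isAlmostLipschitzPath_zero fun δ hδ => ?_
    obtain ⟨K, ⟨f, hf⟩, hK⟩ := exists_lt_of_csInf_lt hne (lt_add_of_pos_right (sInf A) hδ)
    refine ⟨f, hf.source, hf.target, hf.mem, fun s t h0 hst h1 => ?_⟩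
    have := hf.dist_le s t h0 hst h1
    nlinarith [csInf_le hbdd (show K ∈ A from ⟨f, hf⟩)]
  have hK0 : 0 < sInf A := (dist_pos.2 hxy).trans_le (hpos _ hmin)
  obtain ⟨γ, hγ⟩ := hmin
  have hlip : LipschitzOnWith (sInf A).toNNReal γ (Set.Icc 0 1) := by
    refine LipschitzOnWith.of_dist_le_mul fun s hs t ht => ?_
    rw [Real.coe_toNNReal _ hK0.le, Real.dist_eq]
    rcases le_total s t with h | h
    · rw [abs_sub_comm, abs_of_nonneg (sub_nonneg.2 h)]
      simpa using hγ.dist_le s t hs.1 h ht.2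
    · rw [abs_of_nonneg (sub_nonneg.2 h), dist_comm]
      simpa using hγ.dist_le t s ht.1 h hs.2
  have hlt : ∀ s t, 0 ≤ s → s < t → t ≤ 1 → γ s ≠ γ t := by
    intro s t h0 hst h1 heq
    have := csInf_le hbdd (hγ.cut h0 hst.le h1 heq)
    nlinarith
  refine ⟨γ, hlip.continuousOn, ?_, hγ.source, hγ.target, hγ.mem⟩
  intro s hs t ht heq
  by_contra h
  rcases lt_or_gt_of_ne h with h | h
  · exact hlt s t hs.1 h ht.2 heq
  · exact hlt t s ht.1 h hs.2 heq.symm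

/-! ### Tubes around arcs -/

section
variable {n : ℕ} {γ : ℝ → EuclideanSpace ℝ (Fin (n + 1))} {ρ : ℝ}

/-- Induction on the smallest parameter `t` of `F`: what leaves the ball at `γ t` is charged to the
arc from `a` to `t`, the rest to the arc from `t` to `b`. Hence `a` varies while `b` stays fixed. -/
theorem volume_biUnion_ball_diff_ball_le (hρ : 0 < ρ) {b : ℝ} (F : Finset ℝ) :
    ∀ a ≤ b, (∀ t ∈ F, a ≤ t ∧ t ≤ b) → ContinuousOn γ (Set.Icc a b) →
      Set.InjOn γ (Set.Icc a b) →
      volume ((Metric.ball (γ a) ρ ∪ ⋃ t ∈ F, Metric.ball (γ t) ρ) \ Metric.ball (γ b) ρ) ≤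
        volume (Metric.ball (0 : EuclideanSpace ℝ (Fin n)) ρ) *
          Measure.hausdorffMeasure 1 (γ '' Set.Icc a b) := by
  have hchord : ∀ a c, a ≤ c → ContinuousOn γ (Set.Icc a c) →
      volume (Metric.ball (γ a) ρ \ Metric.ball (γ c) ρ) ≤
        volume (Metric.ball (0 : EuclideanSpace ℝ (Fin n)) ρ) *
          Measure.hausdorffMeasure 1 (γ '' Set.Icc a c) := by
    intro a c hac hc
    refine (volume_ball_diff_ball_le _ _ hρ).trans ?_
    gcongr
    exact (isPreconnected_Icc.image γ hc).edist_le_hausdorffMeasure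
      ⟨a, Set.left_mem_Icc.2 hac, rfl⟩ ⟨c, Set.right_mem_Icc.2 hac, rfl⟩
  induction F using Finset.induction_on_min with
  | empty =>
    intro a hab _ hc _
    simpa using hchord a b hab hc
  | insert t F htF ih =>
    intro a hab hF hc hinj
    obtain ⟨hat, htb⟩ := hF t (Finset.mem_insert_self _ _)
    have hsub := Set.Icc_subset_Icc_left (b := b) hat
    have ih' := ih t htb (fun s hs => ⟨(htF s hs).le, (hF s (Finset.mem_insert_of_mem hs)).2⟩)
      (hc.mono hsub) (hinj.mono hsub)
    have hcover : (Metric.ball (γ a) ρ ∪ ⋃ s ∈ insert t F, Metric.ball (γ s) ρ) \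
        Metric.ball (γ b) ρ ⊆ (Metric.ball (γ a) ρ \ Metric.ball (γ t) ρ) ∪
        ((Metric.ball (γ t) ρ ∪ ⋃ s ∈ F, Metric.ball (γ s) ρ) \ Metric.ball (γ b) ρ) := by
      rw [Finset.set_biUnion_insert]
      intro z
      simp only [Set.mem_sdiff, Set.mem_union]
      tauto
    calc _ ≤ _ := measure_mono hcover
      _ ≤ _ := measure_union_le _ _
      _ ≤ _ := add_le_add (hchord a t hat (hc.mono (Set.Icc_subset_Icc_right htb))) ih'
      _ ≤ _ := by
        rw [← mul_add]
        gcongr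
        exact hausdorffMeasure_image_Icc_add_le hat htb hc hinj

/-- The tubular neighbourhood of an arc exceeds the ball around its endpoint by at most the volume
of a cylinder over the arc. -/
theorem volume_thickening_image_diff_ball_le (hρ : 0 < ρ) {a b : ℝ} (hab : a ≤ b)
    (hc : ContinuousOn γ (Set.Icc a b)) (hinj : Set.InjOn γ (Set.Icc a b)) :
    volume (Metric.thickening ρ (γ '' Set.Icc a b) \ Metric.ball (γ b) ρ) ≤
      volume (Metric.ball (0 : EuclideanSpace ℝ (Fin n)) ρ) *
        Measure.hausdorffMeasure 1 (γ '' Set.Icc a b) := by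
  -- By inner regularity a compact subset suffices, and finitely many balls cover it.
  rw [(Metric.isOpen_thickening.measurableSet.diff
    measurableSet_ball).measure_eq_iSup_isCompact]
  refine iSup₂_le fun K hK => iSup_le fun hKc => ?_
  have hcover : K ⊆ ⋃ t ∈ Set.Icc a b, Metric.ball (γ t) ρ := by
    refine (hK.trans Set.sdiff_subset).trans ?_
    rw [Metric.thickening_eq_biUnion_ball, Set.biUnion_image]
  obtain ⟨F, hFs, hFf, hF⟩ := hKc.elim_finite_subcover_image (fun _ _ => Metric.isOpen_ball) hcover
  refine le_trans (measure_mono ?_) (volume_biUnion_ball_diff_ball_le hρ hFf.toFinset a hab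
    (fun t ht => hFs (hFf.mem_toFinset.1 ht)) hc hinj)
  intro z hz
  refine ⟨Or.inr ?_, (hK hz).2⟩
  simpa using hF hz

end

/-! ### Tubes around continua -/

/-- A compact subset of a continuum of finite length can be enlarged by an arc that joins it to a
given point and meets it only at its endpoint. -/
theorem IsPreconnected.exists_arc_to_isCompact {X : Type*} [MetricSpace X]
    [MeasurableSpace X] [BorelSpace X] {S : Set X} (hS : IsPreconnected S)
    (hcomp : IsCompact S) (hfin : Measure.hausdorffMeasure 1 S ≠ ∞) {T : Set X}
    (hT : IsCompact T) (hTS : T ⊆ S) (hne : T.Nonempty) {z : X} (hz : z ∈ S) (hzT : z ∉ T) :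
    ∃ (γ : ℝ → X) (b : ℝ), 0 ≤ b ∧ ContinuousOn γ (Set.Icc 0 b) ∧ Set.InjOn γ (Set.Icc 0 b) ∧
      γ 0 = z ∧ γ b ∈ T ∧ (∀ t, γ t ∈ S) ∧ ∀ t ∈ Set.Icc 0 b, γ t ∈ T → t = b := by
  obtain ⟨q, hq⟩ := hne
  obtain ⟨γ, hc, hinj, h0, h1, hγS⟩ := hS.exists_injOn_path hcomp hfin hz (hTS hq)
    (fun h => hzT (h ▸ hq))
  have hclosed : IsClosed (Set.Icc (0 : ℝ) 1 ∩ γ ⁻¹' T) :=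
    hc.preimage_isClosed_of_isClosed isClosed_Icc hT.isClosed
  have hK : IsCompact (Set.Icc (0 : ℝ) 1 ∩ γ ⁻¹' T) :=
    isCompact_Icc.of_isClosed_subset hclosed Set.inter_subset_left
  -- Stop the arc at its first hitting time of `T`.
  obtain ⟨b, hb, hmin⟩ := hK.exists_isLeast ⟨1, ⟨zero_le_one, le_rfl⟩, by simpa [h1] using hq⟩
  have hsub : Set.Icc 0 b ⊆ Set.Icc 0 1 := Set.Icc_subset_Icc_right hb.1.2
  exact ⟨γ, b, hb.1.1, hc.mono hsub, hinj.mono hsub, h0, hb.2, hγS, fun t ht htT =>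
    le_antisymm ht.2 (hmin ⟨hsub ht, htT⟩)⟩

section
variable {n : ℕ}

/-- Every finite subset of a continuum of finite length lies in a compact part of the continuum
whose tubular neighbourhoods satisfy the volume bound. -/
theorem exists_isCompact_volume_thickening_le {S : Set (EuclideanSpace ℝ (Fin (n + 1)))}
    (hS : IsConnected S) (hcomp : IsCompact S) (hfin : Measure.hausdorffMeasure 1 S ≠ ∞)
    {ρ : ℝ} (hρ : 0 < ρ) (F : Finset (EuclideanSpace ℝ (Fin (n + 1)))) (hF : ↑F ⊆ S) :
    ∃ T ⊆ S, IsCompact T ∧ T.Nonempty ∧ ↑F ⊆ T ∧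
      volume (Metric.thickening ρ T) ≤
        volume (Metric.ball (0 : EuclideanSpace ℝ (Fin (n + 1))) ρ) +
        volume (Metric.ball (0 : EuclideanSpace ℝ (Fin n)) ρ) * Measure.hausdorffMeasure 1 T := by
  have := Measure.nullSingletonClass_hausdorff (EuclideanSpace ℝ (Fin (n + 1)))
    (zero_lt_one (α := ℝ))
  induction F using Finset.induction_on with
  | empty =>
    obtain ⟨x, hx⟩ := hS.nonempty
    refine ⟨{x}, by simpa using hx, isCompact_singleton, Set.singleton_nonempty x, by simp, ?_⟩
    rw [Metric.thickening_singleton, Measure.addHaar_ball_center]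
    exact le_self_add
  | insert z F _ ih =>
    rw [Finset.coe_insert, Set.insert_subset_iff] at hF
    obtain ⟨T, hTS, hTc, hTne, hFT, hvol⟩ := ih hF.2
    by_cases hzT : z ∈ T
    · refine ⟨T, hTS, hTc, hTne, ?_, hvol⟩
      rw [Finset.coe_insert, Set.insert_subset_iff]
      exact ⟨hzT, hFT⟩
    obtain ⟨γ, b, hb, hc, hinj, h0, hbT, hγS, hhit⟩ :=
      hS.isPreconnected.exists_arc_to_isCompact hcomp hfin hTc hTS hTne hF.1 hzT
    set A := γ '' Set.Icc 0 b with hA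
    have hAc : IsCompact A := isCompact_Icc.image_of_continuousOn hc
    have hAT : A ⊆ insert (γ b) (A \ T) := by
      rintro _ ⟨t, ht, rfl⟩
      by_cases h : γ t ∈ T
      · exact Or.inl (congrArg γ (hhit t ht h))
      · exact Or.inr ⟨⟨t, ht, rfl⟩, h⟩
    have hlen : Measure.hausdorffMeasure 1 T + Measure.hausdorffMeasure 1 A ≤
        Measure.hausdorffMeasure 1 (T ∪ A) := by
      rw [← Set.union_sdiff_self, measure_union Set.disjoint_sdiff_right
        (hAc.isClosed.measurableSet.diff hTc.isClosed.measurableSet)]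
      refine add_le_add_right ?_ _
      exact (measure_mono hAT).trans
        (measure_congr (insert_ae_eq_self (μ := Measure.hausdorffMeasure 1) _ _)).le
    have hcover : Metric.thickening ρ (T ∪ A) ⊆
        Metric.thickening ρ T ∪ (Metric.thickening ρ A \ Metric.ball (γ b) ρ) := by
      rw [Metric.thickening_union]
      intro w hw
      by_cases h : w ∈ Metric.thickening ρ T
      · exact Or.inl h
      · refine Or.inr ⟨hw.resolve_left h, fun h' => h ?_⟩
        exact Metric.mem_thickening_iff.2 ⟨γ b, hbT, h'⟩
    refine ⟨T ∪ A, Set.union_subset hTS ?_, hTc.union hAc, hTne.inl, ?_, ?_⟩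
    · rintro _ ⟨t, -, rfl⟩
      exact hγS t
    · rw [Finset.coe_insert, Set.insert_subset_iff]
      exact ⟨Or.inr ⟨0, Set.left_mem_Icc.2 hb, h0⟩, hFT.trans Set.subset_union_left⟩
    · calc _ ≤ _ := measure_mono hcover
        _ ≤ _ := measure_union_le _ _
        _ ≤ _ := add_le_add hvol (volume_thickening_image_diff_ball_le hρ hb hc hinj)
        _ ≤ _ := by
          rw [add_assoc, ← mul_add]
          gcongr

/-- Volume bound for the tubular neighbourhoods of a continuum. -/
theorem IsConnected.volume_cthickening_le {S : Set (EuclideanSpace ℝ (Fin (n + 1)))}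
    (hS : IsConnected S) (hcomp : IsCompact S) (hfin : Measure.hausdorffMeasure 1 S ≠ ∞)
    {r ρ : ℝ} (hr : 0 ≤ r) (hρ : r < ρ) :
    volume (Metric.cthickening r S) ≤
      volume (Metric.ball (0 : EuclideanSpace ℝ (Fin (n + 1))) ρ) +
      volume (Metric.ball (0 : EuclideanSpace ℝ (Fin n)) ρ) * Measure.hausdorffMeasure 1 S := by
  -- A net of mesh `(ρ - r) / 2` suffices, as `r + (ρ - r) / 2 < ρ`.
  obtain ⟨F, hFS, hFf, hF⟩ := hcomp.finite_cover_balls (half_pos (sub_pos.2 hρ))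
  obtain ⟨T, hTS, -, -, hFT, hvol⟩ := exists_isCompact_volume_thickening_le hS hcomp hfin
    (hr.trans_lt hρ) hFf.toFinset (by simpa using hFS)
  refine (measure_mono ?_).trans (hvol.trans (by gcongr))
  intro x hx
  rw [hcomp.cthickening_eq_biUnion_closedBall hr, Set.mem_iUnion₂] at hx
  obtain ⟨y, hy, hxy⟩ := hx
  obtain ⟨z, hz, hyz⟩ := Set.mem_iUnion₂.1 (hF hy)
  refine Metric.mem_thickening_iff.2 ⟨z, hFT (by simpa using hz), ?_⟩
  have := dist_triangle x y z
  rw [Metric.mem_closedBall] at hxy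
  rw [Metric.mem_ball] at hyz
  linarith

end

/-! ### The lower bound on length -/

theorem volume_ball_eq_omega_mul_pow (k : ℕ) {ρ : ℝ} (hρ : 0 < ρ) :
    volume (Metric.ball (0 : EuclideanSpace ℝ (Fin k)) ρ) =
      ENNReal.ofReal (MaximalDistance.omega k * ρ ^ k) := by
  rw [Measure.addHaar_ball_of_pos _ _ hρ, MaximalDistance.omega, mul_comm,
    ENNReal.ofReal_mul ENNReal.toReal_nonneg, ENNReal.ofReal_toReal measure_ball_lt_top.ne,
    finrank_euclideanSpace_fin]

theorem omega_pos (k : ℕ) : 0 < MaximalDistance.omega k :=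
  ENNReal.toReal_pos (Metric.measure_ball_pos _ _ one_pos).ne' measure_ball_lt_top.ne

/-- Here `μHE[d]` is the `d`-dimensional Hausdorff measure in the normalization that agrees with
Lebesgue measure on `ℝ^d` (for dimension one this is the usual `Measure.hausdorffMeasure 1`). -/
theorem mainTheorem2 (d : ℕ) (hd : 1 ≤ d) (V r : ℝ) (hV : 0 < V) (hr : 0 < r)
    (M : Set (EuclideanSpace ℝ (Fin d))) (hM : IsCompact M)
    (hMV : Measure.euclideanHausdorffMeasure d M = ENNReal.ofReal V)
    (S : Set (EuclideanSpace ℝ (Fin d))) (hS : MaximalDistance.IsRMinimizer M r S) :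
    ENNReal.ofReal (max 0 ((V - MaximalDistance.omega d * r ^ d) /
        (MaximalDistance.omega (d - 1) * r ^ (d - 1)))) ≤ MaximalDistance.length S := by
  obtain ⟨n, rfl⟩ := Nat.exists_eq_add_of_le' hd
  rw [Nat.add_sub_cancel]
  by_cases hfin : MaximalDistance.length S = ∞
  · rw [hfin]; exact le_top
  obtain ⟨hScomp, hSconn, hE⟩ := hS.isAdmissible
  set L := (MaximalDistance.length S).toReal with hL
  have hL0 : 0 ≤ L := ENNReal.toReal_nonneg
  have hω := omega_pos (n + 1)
  have hω' := omega_pos n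
  have hMS : M ⊆ Metric.cthickening r S := fun y hy =>
    Metric.mem_cthickening_iff.2
      ((le_iSup₂ (f := fun y (_ : y ∈ M) => Metric.infEDist y S) y hy).trans hE)
  have hbound : ∀ ρ, r < ρ → V ≤ MaximalDistance.omega (n + 1) * ρ ^ (n + 1) +
      MaximalDistance.omega n * ρ ^ n * L := by
    intro ρ hρ
    have hρ0 : 0 < ρ := hr.trans hρ
    have h := (measure_mono hMS).trans (hSconn.volume_cthickening_le hScomp hfin hr.le hρ)
    rw [← EuclideanSpace.euclideanHausdorffMeasure_eq_volume, hMV,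
      EuclideanSpace.euclideanHausdorffMeasure_eq_volume,
      volume_ball_eq_omega_mul_pow _ hρ0, volume_ball_eq_omega_mul_pow _ hρ0,
      show Measure.hausdorffMeasure 1 S = ENNReal.ofReal L from (ENNReal.ofReal_toReal hfin).symm,
      ← ENNReal.ofReal_mul (by positivity), ← ENNReal.ofReal_add (by positivity) (by positivity),
      ENNReal.ofReal_le_ofReal_iff (by positivity)] at h
    exact h
  have hlim : V ≤ MaximalDistance.omega (n + 1) * r ^ (n + 1) +
      MaximalDistance.omega n * r ^ n * L := by
    have hcont : Continuous fun ρ : ℝ => MaximalDistance.omega (n + 1) * ρ ^ (n + 1) +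
      MaximalDistance.omega n * ρ ^ n * L := by fun_prop
    exact ge_of_tendsto (hcont.continuousWithinAt (s := Set.Ioi r) (x := r))
      (Filter.eventually_of_mem self_mem_nhdsWithin hbound)
  refine ENNReal.ofReal_le_of_le_toReal (max_le hL0 ?_)
  rw [div_le_iff₀ (by positivity)]
  linarith
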